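/- Let $b\ge 2$ and $m,s\ge 1$ be integers, and identify $\mathbb{Z}_b=\mathbb{Z}/b\mathbb{Z}$ with $\{0,\dots,b-1\}$. Write $\omega_b=\exp(2\pi\sqrt{-1}/b)$. *Digits and Walsh functions.* For $k\in\mathbb{N}_0$ with $b$-adic expansion $k=\kappa_0+\kappa_1b+\cdots$ put $\vec{k}=(\kappa_0,\kappa_1,\dots)$ and $\delta(k)=\sum_{i}\kappa_i \bmod b$; for $\boldsymbol{k}=(k_1,\dots,k_s)\in\mathbb{N}_0^s$ put $\delta(\boldsymbol{k})=\sum_{j=1}^s\delta(k_j)\bmod b$. For $x\in[0,1]$ write $x=\xi_1/b+\xi_2/b^2+\cdots$ with $\xi_i\in\mathbb{Z}_b$, where infinitely many $\xi_i$ differ from $b-1$ if $x<1$, and all $\xi_i=b-1$ if $x=1$. Let $\mathrm{wal}_k(x)=\omega_b^{\kappa_0\xi_1+\kappa_1\xi_2+\cdots}$ and $\mathrm{wal}_{\boldsymbol{k}}(\boldsymbol{x})=\prod_{j=1}^s\mathrm{wal}_{k_j}(x_j)$ for $\boldsymbol{x}\in[0,1]^s$. *Digital nets.* Let $G=\prod_{i\ge1}\mathbb{Z}_b$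 with componentwise addition $\oplus$, and let $\pi:G\to[0,1]$, $\pi(\zeta_1,\zeta_2,\dots)=\sum_{i\ge1}\zeta_ib^{-i}$, be applied componentwise on $G^s$. Given matrices $C_1,\dots,C_s\in\mathbb{Z}_b^{\mathbb{N}\times m}$, the digital net $\mathcal{P}=\{\boldsymbol{z}_0,\dots,\boldsymbol{z}_{b^m-1}\}\subset G^s$ is defined by $z_{h,j}^{\top}=C_j(\eta_0,\dots,\eta_{m-1})^{\top}$ for $h=\eta_0+\eta_1b+\cdots+\eta_{m-1}b^{m-1}$. Its dual net is $$\mathcal{P}^{\perp}=\{\boldsymbol{k}\in\mathbb{N}_0^s:\ \vec{k}_1C_1\oplus\cdots\oplus\vec{k}_sC_s=\boldsymbol{0}\in\mathbb{Z}_b^m\},$$ and its $b$-adic antithetic sampling is $\mathcal{P}_{b\text{-ant}}=\bigcup_{l\in\mathbb{Z}_b}\{\boldsymbol{z}\oplus\boldsymbol{e}_l:\boldsymbol{z}\in\mathcal{P}\}$, where every component of $\boldsymbol{e}_l\in G^s$ is $(l,l,\dots)$. Points are always counted according to their multiplicity, so that $\mathcal{P}_{b\text{-ant}}$ and $\pi(\mathcal{P}_{b\text{-ant}})$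 have $b^{m+1}$ points. *Worst-case error.* For a finite point set $P\subset[0,1]^s$ and $f:[0,1]^s\to\mathbb{R}$ let $I(f;P)=\frac1{|P|}\sum_{\boldsymbol{x}\in P}f(\boldsymbol{x})$ and $I(f)=\int_{[0,1]^s}f(\boldsymbol{x})\,d\boldsymbol{x}$. For a reproducing kernel Hilbert space $H$ of real functions on $[0,1]^s$ with reproducing kernel $K$ let $$e^{\mathrm{wor}}(H;P)=\sup_{f\in H,\ \|f\|_H\le1}|I(f;P)-I(f)|,\qquad \hat K(\boldsymbol{k},\boldsymbol{l})=\int_{[0,1]^{2s}}K(\boldsymbol{x},\boldsymbol{y})\,\overline{\mathrm{wal}_{\boldsymbol{k}}(\boldsymbol{x})}\,\mathrm{wal}_{\boldsymbol{l}}(\boldsymbol{y})\,d\boldsymbol{x}\,d\boldsymbol{y}.$$ **Theorem.** Let $\mathcal{P}$ be a digital net over $\mathbb{Z}_b$ in $G^s$ with dual net $\mathcal{P}^\perp$, and let $H$ be a reproducing kernel Hilbert space of real functions on $[0,1]^s$ whose reproducing kernel $K:[0,1]^s\times[0,1]^s\to\mathbb{R}$ is continuous and satisfies $\int_{[0,1]^s}\sqrt{K(\boldsymbol{x},\boldsymbol{x})}\,d\boldsymbol{x}<\infty$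 and $\sum_{\boldsymbol{k},\boldsymbol{l}\in\mathbb{N}_0^s}|\hat K(\boldsymbol{k},\boldsymbol{l})|<\infty$. Then every $f\in H$ is integrable, $e^{\mathrm{wor}}(H;\pi(\mathcal{P}_{b\text{-ant}}))$ is finite, and $$\bigl(e^{\mathrm{wor}}(H;\pi(\mathcal{P}_{b\text{-ant}}))\bigr)^2=\sum_{\substack{\boldsymbol{k},\boldsymbol{l}\in\mathcal{P}^{\perp}\setminus\{\boldsymbol{0}\}\\ \delta(\boldsymbol{k})=\delta(\boldsymbol{l})=0}}\hat K(\boldsymbol{k},\boldsymbol{l}),$$ where the series on the right converges absolutely. -/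

import Mathlib

open MeasureTheory
open scoped Matrix

noncomputable section

namespace QMC

/-- The unit cube `[0,1]^s`, with its product topology and Lebesgue measure. -/
abbrev Cube (s : ℕ) : Type := Fin s → unitInterval

/-- The group `G = ∏_{i ≥ 1} ℤ_b` with componentwise addition modulo `b`.
The digit `ζ_{i+1}` of `z` is `z i`. -/
abbrev DigitGroup (b : ℕ) : Type := ℕ → ZMod b

/-- The `i`-th digit `κ_i` of `k = κ_0 + κ_1 b + κ_2 b² + ⋯`. -/
def natDigit (b k i : ℕ) : ℕ := (Nat.digits b k).getD i 0

/-- The projection `π : G → [0,1]`, `π(ζ_1, ζ_2, …) = ζ_1 / b + ζ_2 / b² + ⋯`. -/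
def proj {b : ℕ} [NeZero b] (z : DigitGroup b) : unitInterval :=
  ⟨Real.ofDigits fun i => (⟨(z i).val, ZMod.val_lt (z i)⟩ : Fin b),
    Real.ofDigits_nonneg _, Real.ofDigits_le_one _⟩

/-- The projection `π`, applied componentwise. -/
def projCube {b s : ℕ} [NeZero b] (z : Fin s → DigitGroup b) : Cube s := fun j => proj (z j)

/-- The digits `ξ_1, ξ_2, …` of `x ∈ [0,1]`: the expansion with infinitely many digits
different from `b - 1` if `x < 1`, and all digits equal to `b - 1` if `x = 1`. -/
def unitDigits (b : ℕ) (x : unitInterval) : DigitGroup b := fun i =>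
  if x = 1 then ((b - 1 : ℕ) : ZMod b) else ((⌊(x : ℝ) * (b : ℝ) ^ (i + 1)⌋₊ : ℕ) : ZMod b)

/-- The primitive root of unity `ω_b = exp(2π√-1 / b)`. -/
def rootOfUnity (b : ℕ) : ℂ := Complex.exp (2 * Real.pi * Complex.I / b)

/-- The `k`-th Walsh function `wal_k(x) = ω_b ^ (κ_0 ξ_1 + κ_1 ξ_2 + ⋯)`. -/
def walsh (b k : ℕ) (x : unitInterval) : ℂ :=
  rootOfUnity b ^
    ∑ i ∈ Finset.range (Nat.digits b k).length, natDigit b k i * (unitDigits b x i).val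

/-- The multivariate Walsh function `wal_k(x) = ∏_j wal_{k_j}(x_j)`. -/
def walshCube (b : ℕ) {s : ℕ} (k : Fin s → ℕ) (x : Cube s) : ℂ := ∏ j, walsh b (k j) (x j)

/-- The Walsh coefficient
`K̂(k,l) = ∫ K(x,y) * conj(wal_k(x)) * wal_l(y) d(x,y)` over `[0,1]^s × [0,1]^s`. -/
def walshCoeff (b : ℕ) {s : ℕ} (K : Cube s → Cube s → ℝ) (k l : Fin s → ℕ) : ℂ :=
  ∫ p : Cube s × Cube s,
    (K p.1 p.2 : ℂ) * (starRingEnd ℂ) (walshCube b k p.1) * walshCube b l p.2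

/-- The point `z_h` of the digital net: `z_{h,j} = C_j (η_0, …, η_{m-1})ᵀ`, where
`h = η_0 + η_1 b + ⋯ + η_{m-1} b^{m-1}`. -/
def netPoint {b m s : ℕ} (C : Fin s → Matrix ℕ (Fin m) (ZMod b)) (h : ℕ) :
    Fin s → DigitGroup b :=
  fun j => C j *ᵥ fun c => (natDigit b h c : ZMod b)

/-- The digital net `{z_0, …, z_{b^m - 1}}` over `ℤ_b` in `G^s` with generating matrices
`C_1, …, C_s`; points are counted according to their multiplicity. -/
def digitalNet {b m s : ℕ} (C : Fin s → Matrix ℕ (Fin m) (ZMod b)) :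
    Multiset (Fin s → DigitGroup b) :=
  (Multiset.range (b ^ m)).map (netPoint C)

/-- The `b`-adic antithetic sampling `⋃_{l ∈ ℤ_b} {z ⊕ e_l : z ∈ P}`, where every component
of `e_l` is the constant sequence `(l, l, …)`; points are counted according to their
multiplicity. -/
def antithetic {b s : ℕ} [NeZero b] (P : Multiset (Fin s → DigitGroup b)) :
    Multiset (Fin s → DigitGroup b) :=
  (Finset.univ : Finset (ZMod b)).val.bind fun l => P.map fun z => z + fun _ _ => l

/-- The dual net: all `k` with `k⃗_1 C_1 ⊕ ⋯ ⊕ k⃗_s C_s = 0` in `ℤ_b^m`, where `k⃗` is the row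
vector of the digits of `k`. -/
def dualNet {b m s : ℕ} (C : Fin s → Matrix ℕ (Fin m) (ZMod b)) : Set (Fin s → ℕ) :=
  {k | ∀ c : Fin m, ∑ j, ∑ i ∈ Finset.range (Nat.digits b (k j)).length,
    (natDigit b (k j) i : ZMod b) * C j i c = 0}

/-- The sum of digits modulo `b`, `δ(k) = ∑_j δ(k_j)`. -/
def digitSum (b : ℕ) {s : ℕ} (k : Fin s → ℕ) : ZMod b :=
  ∑ j, ((Nat.digits b (k j)).sum : ZMod b)

/-- The quadrature rule `I(f; P) = |P|⁻¹ ∑_{x ∈ P} f(x)` of a finite point (multi)set. -/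
def quadrature {s : ℕ} (f : Cube s → ℝ) (P : Multiset (Cube s)) : ℝ :=
  (P.map f).sum / (Multiset.card P : ℝ)

section WorstCase

variable (H : Type*) [NormedAddCommGroup H] [InnerProductSpace ℝ H] {s : ℕ}
  [RKHS ℝ H (Cube s) ℝ]

/-- The integration errors `|I(f; P) - I(f)|` over the unit ball of `H`. -/
def unitBallErrors (P : Multiset (Cube s)) : Set ℝ :=
  {e | ∃ f : H, ‖f‖ ≤ 1 ∧ e = |quadrature (fun x => f x) P - ∫ x : Cube s, f x|}

/-- The worst-case error `sup_{‖f‖ ≤ 1} |I(f; P) - I(f)|`. -/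
def worstCaseError (P : Multiset (Cube s)) : ℝ := sSup (unitBallErrors H P)

/-- The real-valued reproducing kernel of `H`, `K(x,y) = ⟨K_x, K_y⟩`: `RKHS.kernel` is valued
in the linear maps `ℝ → ℝ`, which are identified with their values at `1`. -/
def reproducingKernel [CompleteSpace H] (x y : Cube s) : ℝ := RKHS.kernel H x y 1

end WorstCase

end QMC

end

/-!
The integration error `f ↦ I(f; P) - I(f)` is a bounded functional on `H`, represented by
`g = |P|⁻¹ ∑_{z ∈ P} K_{π(z)} - ∫ K_u du`, where `K_u` is the kernel function at `u`; by
Cauchy–Schwarz the worst-case error is `‖g‖` (`isGreatest_unitBallErrors`). Continuity of the kernel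
makes `u ↦ K_u` norm continuous (`continuous_kernelSection`), so `K_{π(z)}` is the limit, as
`n → ∞`, of the averages of `K_u` over the cylinder of those `u` whose first `n` digits agree with
those of `z` (`tendsto_average_cylinder`). This holds even when the digits of `π(z)` differ from
`z`, which happens if `z` ends in digits `b - 1`; evaluating Walsh functions at `π(z)` is thereby
avoided.

Hence `g` is the limit of `∫ w_n(u) K_u du` for the step functions
`w_n = b^(ns) |P|⁻¹ ∑_{z ∈ P} 1_{cyl_n(z)} - 1`. The normalized indicator of a cylinder is a
Walsh–Dirichlet kernel (`indicator_cylinder_eq_sum`), and a character of `G^s` averages over the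
antithetic net to `1` or `0` according to whether its index is in the dual net with digit sum zero
(`sum_stdAddChar_antithetic`). So `w_n` is the sum of the conjugated Walsh functions whose indices
are such vectors, nonzero and with entries below `b^n` (`errorDensity_eq_sum`), and
`‖∫ w_n(u) K_u du‖²` is exactly the partial sum of the Walsh coefficients over these pairs of
indices (`norm_sq_integral_errorDensity`). Absolute summability identifies the limit of these
partial sums with the sum of the series.
-/

namespace QMC

/-! ### The characters of the digit group -/

section Characters

variable {b : ℕ} {s : ℕ}

/-- The pairing `⟨k, z⟩ = κ_0 ζ_1 + κ_1 ζ_2 + ⋯ ∈ ℤ_b` of an integer with a digit sequence. -/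
def pairing (k : ℕ) (z : DigitGroup b) : ZMod b :=
  ∑ i ∈ Finset.range (Nat.digits b k).length, (natDigit b k i : ZMod b) * z i

/-- The pairing `⟨k, z⟩ = ∑_j ⟨k_j, z_j⟩` of an integer vector with an element of `G^s`. The
characters of `G^s` are the functions `z ↦ ω_b ^ ⟨k, z⟩`. -/
def pairingCube (k : Fin s → ℕ) (z : Fin s → DigitGroup b) : ZMod b :=
  ∑ j, pairing (k j) (z j)

/-- The digits of a point of the cube, componentwise. -/
noncomputable def cubeDigits (b : ℕ) (u : Cube s) : Fin s → DigitGroup b :=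
  fun j => unitDigits b (u j)

theorem pairing_add (k : ℕ) (y z : DigitGroup b) :
    pairing k (y + z) = pairing k y + pairing k z := by
  simp [pairing, mul_add, Finset.sum_add_distrib]

theorem pairing_sub (k : ℕ) (y z : DigitGroup b) :
    pairing k (y - z) = pairing k y - pairing k z := by
  simp [pairing, mul_sub, Finset.sum_sub_distrib]

theorem pairingCube_add (k : Fin s → ℕ) (y z : Fin s → DigitGroup b) :
    pairingCube k (y + z) = pairingCube k y + pairingCube k z := by
  simp [pairingCube, pairing_add, Finset.sum_add_distrib]

theorem pairingCube_sub (k : Fin s → ℕ) (y z : Fin s → DigitGroup b) :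
    pairingCube k (y - z) = pairingCube k y - pairingCube k z := by
  simp [pairingCube, pairing_sub, Finset.sum_sub_distrib]

theorem pairingCube_zero_left (z : Fin s → DigitGroup b) : pairingCube 0 z = 0 := by
  simp [pairingCube, pairing]

theorem pairing_of_lt {n k : ℕ} (hb : 2 ≤ b) (hk : k < b ^ n) (z : DigitGroup b) :
    pairing k z = ∑ i : Fin n, (natDigit b k i : ZMod b) * z i := by
  rw [← Finset.sum_range fun i => (natDigit b k i : ZMod b) * z i, pairing]
  refine Finset.sum_subset (Finset.range_mono ?_) fun i _ hi => ?_
  · exact (Nat.digits_length_le_iff (by lia) k).2 hk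
  · have : natDigit b k i = 0 := List.getD_eq_default _ _ (by simpa using hi)
    simp [this]

theorem pairingCube_const (k : Fin s → ℕ) (l : ZMod b) :
    pairingCube k (fun _ _ => l) = l * digitSum b k := by
  rw [pairingCube, digitSum, Finset.mul_sum]
  refine Finset.sum_congr rfl fun j _ => ?_
  rw [pairing, ← Finset.sum_mul, mul_comm, ← Nat.cast_sum]
  congr 2
  rw [Finset.sum_range, ← Fin.sum_univ_getElem]
  exact Finset.sum_congr rfl fun i _ => by simp [natDigit]

variable [NeZero b]

theorem stdAddChar_sum {ι : Type*} (t : Finset ι) (a : ι → ZMod b) :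
    (ZMod.stdAddChar (∑ i ∈ t, a i) : ℂ) = ∏ i ∈ t, ZMod.stdAddChar (a i) := by
  classical
  induction t using Finset.induction_on with
  | empty => simp
  | insert i t hi ih => rw [Finset.sum_insert hi, Finset.prod_insert hi, AddChar.map_add_eq_mul, ih]

theorem rootOfUnity_eq_stdAddChar : rootOfUnity b = ZMod.stdAddChar (1 : ZMod b) := by
  have := ZMod.stdAddChar_coe (N := b) 1
  simpa [rootOfUnity] using this.symm

theorem walsh_eq_stdAddChar (k : ℕ) (x : unitInterval) :
    walsh b k x = ZMod.stdAddChar (pairing k (unitDigits b x)) := by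
  rw [walsh, rootOfUnity_eq_stdAddChar, ← AddChar.map_nsmul_eq_pow, nsmul_one, pairing]
  simp

theorem walshCube_eq_stdAddChar (k : Fin s → ℕ) (u : Cube s) :
    walshCube b k u = ZMod.stdAddChar (pairingCube k (cubeDigits b u)) := by
  simp only [walshCube, walsh_eq_stdAddChar, pairingCube, cubeDigits]
  exact (stdAddChar_sum _ _).symm

theorem conj_stdAddChar (a : ZMod b) :
    (starRingEnd ℂ) (ZMod.stdAddChar a) = ZMod.stdAddChar (-a) :=
  (AddChar.map_neg_eq_conj _ _).symm

/-- The digit vectors of the integers below `b ^ n` run through `ℤ_b ^ n` exactly once. -/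
theorem sum_range_pow_natDigit (hb : 2 ≤ b) (n : ℕ) {M : Type*} [AddCommMonoid M]
    (F : (Fin n → ZMod b) → M) :
    ∑ k ∈ Finset.range (b ^ n), F (fun i => (natDigit b k i : ZMod b)) = ∑ v, F v := by
  rw [Finset.sum_range fun k => F (fun i => (natDigit b k i : ZMod b))]
  refine Fintype.sum_equiv (finFunctionFinEquiv.symm.trans
    (Equiv.arrowCongr (Equiv.refl _) (ZMod.finEquiv b).toEquiv)) _ _ fun k => ?_
  congr 1
  funext i
  obtain ⟨c, rfl⟩ : ∃ c, b = c + 1 := ⟨b - 1, by lia⟩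
  have h : ((natDigit (c + 1) k i : ℕ) : ZMod (c + 1)).val = k / (c + 1) ^ (i : ℕ) % (c + 1) := by
    rw [natDigit, Nat.getD_digits _ _ hb, ZMod.val_natCast, Nat.mod_mod]
  apply ZMod.val_injective
  rw [h]
  rfl

/-- Orthogonality of the characters of `ℤ_b ^ ι`. -/
theorem sum_stdAddChar_dot {ι : Type*} [Fintype ι] [DecidableEq ι] (w : ι → ZMod b) :
    ∑ v : ι → ZMod b, ZMod.stdAddChar (∑ i, v i * w i) =
      if w = 0 then (b : ℂ) ^ Fintype.card ι else 0 := by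
  have h : ∀ v : ι → ZMod b, (ZMod.stdAddChar (∑ i, v i * w i) : ℂ) =
      ∏ i, ZMod.stdAddChar (v i * w i) := fun v => stdAddChar_sum _ _
  simp_rw [h]
  rw [← Fintype.piFinset_univ,
    Finset.sum_prod_piFinset Finset.univ fun i x => (ZMod.stdAddChar (x * w i) : ℂ)]
  simp_rw [AddChar.sum_mulShift _ (ZMod.isPrimitive_stdAddChar b), ZMod.card]
  split_ifs with hw
  · simp [hw]
  · obtain ⟨i, hi⟩ := Function.ne_iff.1 hw
    exact Finset.prod_eq_zero (Finset.mem_univ i) (by simpa [NeZero.ne b] using hi)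

/-- The Walsh–Dirichlet kernel: the characters of index below `b ^ n` add up to a multiple of the
indicator of the sequences whose first `n` digits vanish. -/
theorem sum_range_stdAddChar_pairing (hb : 2 ≤ b) (n : ℕ) (z : DigitGroup b) :
    ∑ k ∈ Finset.range (b ^ n), (ZMod.stdAddChar (pairing k z) : ℂ) =
      if ∀ i < n, z i = 0 then (b : ℂ) ^ n else 0 := by
  have h : ∑ k ∈ Finset.range (b ^ n), (ZMod.stdAddChar (pairing k z) : ℂ) =
      ∑ k ∈ Finset.range (b ^ n),
        ZMod.stdAddChar (∑ i : Fin n, (natDigit b k i : ZMod b) * z i) :=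
    Finset.sum_congr rfl fun k hk => by rw [pairing_of_lt hb (Finset.mem_range.1 hk)]
  rw [h, sum_range_pow_natDigit hb n
    fun v => (ZMod.stdAddChar (∑ i : Fin n, v i * z i) : ℂ),
    sum_stdAddChar_dot fun i : Fin n => z i]
  simp [funext_iff, Fin.forall_iff]

/-- The integer vectors with all entries below `b ^ n`. -/
def digitBox (b s n : ℕ) : Finset (Fin s → ℕ) :=
  Fintype.piFinset fun _ => Finset.range (b ^ n)

theorem sum_digitBox_stdAddChar (hb : 2 ≤ b) (n : ℕ) (z : Fin s → DigitGroup b) :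
    ∑ k ∈ digitBox b s n, (ZMod.stdAddChar (pairingCube k z) : ℂ) =
      if ∀ j, ∀ i < n, z j i = 0 then (b : ℂ) ^ (n * s) else 0 := by
  have h : ∀ k : Fin s → ℕ, (ZMod.stdAddChar (pairingCube k z) : ℂ) =
      ∏ j, ZMod.stdAddChar (pairing (k j) (z j)) := fun k => stdAddChar_sum _ _
  simp_rw [h]
  rw [digitBox, Finset.sum_prod_piFinset (Finset.range (b ^ n))
    fun j x => (ZMod.stdAddChar (pairing x (z j)) : ℂ)]
  simp_rw [sum_range_stdAddChar_pairing hb]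
  split_ifs with hz
  · rw [Finset.prod_congr rfl fun j _ => if_pos (hz j)]
    simp [pow_mul]
  · push Not at hz
    obtain ⟨j, hj⟩ := hz
    refine Finset.prod_eq_zero (Finset.mem_univ j) (if_neg ?_)
    push Not
    exact hj

/-! ### Character sums over the antithetic net -/

theorem sum_range_stdAddChar_netPoint (hb : 2 ≤ b) {m : ℕ}
    (C : Fin s → Matrix ℕ (Fin m) (ZMod b)) (k : Fin s → ℕ) [Decidable (k ∈ dualNet C)] :
    ∑ h ∈ Finset.range (b ^ m), (ZMod.stdAddChar (pairingCube k (netPoint C h)) : ℂ) =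
      if k ∈ dualNet C then (b : ℂ) ^ m else 0 := by
  have h : ∀ h : ℕ, pairingCube k (netPoint C h) =
      ∑ c : Fin m, (natDigit b h c : ZMod b) * pairingCube k (fun j i => C j i c) := by
    intro h
    simp only [pairingCube, pairing, netPoint, Matrix.mulVec, dotProduct, Finset.mul_sum]
    rw [Finset.sum_comm]
    refine Finset.sum_congr rfl fun j _ => ?_
    rw [Finset.sum_comm]
    refine Finset.sum_congr rfl fun i _ => Finset.sum_congr rfl fun c _ => ?_
    ring
  simp_rw [h]
  rw [sum_range_pow_natDigit hb m fun v =>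
    (ZMod.stdAddChar (∑ c : Fin m, v c * pairingCube k (fun j i => C j i c)) : ℂ),
    sum_stdAddChar_dot fun c : Fin m => pairingCube k (fun j i => C j i c)]
  refine if_congr ?_ (by simp) rfl
  simp [funext_iff, dualNet, pairingCube, pairing]

/-- A character of `G^s` averages to `1` over the antithetic net if its index lies in the dual net
and has digit sum zero, and to `0` otherwise. -/
theorem sum_stdAddChar_antithetic (hb : 2 ≤ b) {m : ℕ}
    (C : Fin s → Matrix ℕ (Fin m) (ZMod b)) (k : Fin s → ℕ)
    [Decidable (k ∈ dualNet C ∧ digitSum b k = 0)] :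
    ∑ p ∈ (Finset.univ : Finset (ZMod b)) ×ˢ Finset.range (b ^ m),
      (ZMod.stdAddChar (pairingCube k (netPoint C p.2 + fun _ _ => p.1)) : ℂ) =
      if k ∈ dualNet C ∧ digitSum b k = 0 then (b : ℂ) ^ (m + 1) else 0 := by
  classical
  simp_rw [pairingCube_add, AddChar.map_add_eq_mul, pairingCube_const]
  rw [Finset.sum_product_right]
  simp_rw [← Finset.mul_sum, AddChar.sum_mulShift _ (ZMod.isPrimitive_stdAddChar b), ZMod.card]
  rw [← Finset.sum_mul, sum_range_stdAddChar_netPoint hb]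
  by_cases h1 : k ∈ dualNet C <;> by_cases h2 : digitSum b k = 0 <;> simp [h1, h2, pow_succ]

theorem quadrature_antithetic {m : ℕ} (C : Fin s → Matrix ℕ (Fin m) (ZMod b))
    (f : Cube s → ℝ) :
    quadrature f ((antithetic (digitalNet C)).map projCube) =
      ((b : ℝ) ^ (m + 1))⁻¹ * ∑ p ∈ (Finset.univ : Finset (ZMod b)) ×ˢ Finset.range (b ^ m),
        f (projCube (netPoint C p.2 + fun _ _ => p.1)) := by
  rw [quadrature, div_eq_inv_mul, Finset.sum_product]
  congr 1
  · simp [antithetic, digitalNet, Multiset.card_bind, ZMod.card, pow_succ, mul_comm]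
  · simp only [antithetic, digitalNet, Multiset.map_bind, Multiset.sum_bind, Multiset.map_map]
    rfl

end Characters

/-! ### Digits and cylinder sets of the cube -/

section Cylinders

variable {b : ℕ} {s : ℕ}

theorem measurable_val_unitDigits (i : ℕ) :
    Measurable fun u : unitInterval => (unitDigits b u i).val := by
  have h : Measurable fun n : ℕ => ((n : ℕ) : ZMod b).val := measurable_from_top
  have h' : (fun u : unitInterval => (unitDigits b u i).val) = fun u : unitInterval =>
      if u = 1 then ((b - 1 : ℕ) : ZMod b).val
      else ((⌊(u : ℝ) * (b : ℝ) ^ (i + 1)⌋₊ : ℕ) : ZMod b).val := by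
    funext u
    simp only [unitDigits]
    split_ifs <;> rfl
  rw [h']
  refine Measurable.ite (measurableSet_singleton 1) measurable_const
    (h.comp (Nat.measurable_floor.comp ?_))
  fun_prop

theorem measurable_walshCube (k : Fin s → ℕ) : Measurable (walshCube b k) := by
  refine Finset.measurable_fun_prod _ fun j _ => ?_
  have h : Measurable fun n : ℕ => rootOfUnity b ^ n := measurable_from_top
  refine h.comp (Finset.measurable_fun_sum _ fun i _ => ?_)
  exact ((measurable_val_unitDigits i).comp (measurable_pi_apply j)).const_mul _

variable [NeZero b]

theorem proj_unitDigits (hb : 2 ≤ b) (u : unitInterval) : proj (unitDigits b u) = u := by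
  apply Subtype.ext
  by_cases hu : u = 1
  · subst hu
    refine Eq.trans ?_ (Real.ofDigits_const_last_eq_one' (b := b) (by lia))
    simp only [proj]
    congr 1
    funext i
    apply Fin.ext
    simp [unitDigits, ZMod.val_natCast]
  · have hu1 : (u : ℝ) < 1 := lt_of_le_of_ne u.2.2 fun h => hu (Subtype.ext h)
    refine Eq.trans ?_ (Real.ofDigits_digits (b := b) (by lia) ⟨u.2.1, hu1⟩)
    simp only [proj]
    congr 1
    funext i
    apply Fin.ext
    simp [unitDigits, hu, Real.digits, ZMod.val_natCast]

/-- The points of `[0,1]` whose first `n` digits agree with those of `z`. -/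
def unitCylinder (n : ℕ) (z : DigitGroup b) : Set unitInterval :=
  {u | ∀ i < n, unitDigits b u i = z i}

theorem measurableSet_unitCylinder (n : ℕ) (z : DigitGroup b) :
    MeasurableSet (unitCylinder n z) := by
  have : unitCylinder n z = ⋂ i, ⋂ (_ : i < n),
      (fun u : unitInterval => (unitDigits b u i).val) ⁻¹' {(z i).val} := by
    ext u
    simp [unitCylinder, (ZMod.val_injective b).eq_iff]
  rw [this]
  exact MeasurableSet.iInter fun i => MeasurableSet.iInter fun _ =>
    measurable_val_unitDigits i (measurableSet_singleton _)

/-- The cylinder of `z` lies close to `π(z)`, even when the digits of `π(z)` are not those of `z`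
and `π(z)` itself lies outside of it. -/
theorem dist_proj_le_of_mem_unitCylinder (hb : 2 ≤ b) {n : ℕ} {z : DigitGroup b}
    {u : unitInterval} (hu : u ∈ unitCylinder n z) : dist u (proj z) ≤ ((b : ℝ) ^ n)⁻¹ := by
  conv_lhs => rw [← proj_unitDigits hb u]
  exact Real.abs_ofDigits_sub_ofDigits_le fun i hi => by simp [hu i hi]

/-- The integer `ζ_1 b^(n-1) + ⋯ + ζ_n` formed by the first `n` digits of `z`. -/
def leadingDigits (z : DigitGroup b) : ℕ → ℕ
  | 0 => 0
  | n + 1 => b * leadingDigits z n + (z n).val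

theorem leadingDigits_lt (z : DigitGroup b) (n : ℕ) : leadingDigits z n < b ^ n := by
  induction n with
  | zero => simp [leadingDigits]
  | succ n ih =>
    have h := ZMod.val_lt (z n)
    have h2 : b * (leadingDigits z n + 1) ≤ b * b ^ n := Nat.mul_le_mul_left b ih
    rw [leadingDigits, pow_succ']
    lia

theorem mem_unitCylinder_iff_floor {u : unitInterval} (hu : u ≠ 1) (n : ℕ) (z : DigitGroup b) :
    u ∈ unitCylinder n z ↔ ⌊(u : ℝ) * (b : ℝ) ^ n⌋₊ = leadingDigits z n := by
  have hu1 : (u : ℝ) < 1 := lt_of_le_of_ne u.2.2 fun h => hu (Subtype.ext h)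
  have hb : 0 < b := Nat.pos_of_neZero b
  induction n with
  | zero => simpa [unitCylinder, leadingDigits, Nat.floor_eq_zero] using hu1
  | succ n ih =>
    have h : u ∈ unitCylinder (n + 1) z ↔ u ∈ unitCylinder n z ∧ unitDigits b u n = z n := by
      simp only [unitCylinder, Set.mem_ofPred_eq, Nat.lt_succ_iff_lt_or_eq]
      constructor
      · exact fun h => ⟨fun i hi => h i (Or.inl hi), h n (Or.inr rfl)⟩
      · rintro ⟨h1, h2⟩ i (hi | rfl)
        exacts [h1 i hi, h2]
    have hdiv : ⌊(u : ℝ) * (b : ℝ) ^ n⌋₊ = ⌊(u : ℝ) * (b : ℝ) ^ (n + 1)⌋₊ / b := by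
      rw [← Nat.floor_div_natCast]
      congr 1
      field_simp
      ring
    have hmod : unitDigits b u n = z n ↔ ⌊(u : ℝ) * (b : ℝ) ^ (n + 1)⌋₊ % b = (z n).val := by
      rw [← (ZMod.val_injective b).eq_iff, unitDigits, if_neg hu, ZMod.val_natCast]
    refine h.trans ((and_congr ih hmod).trans ?_)
    rw [hdiv, leadingDigits]
    generalize ⌊(u : ℝ) * (b : ℝ) ^ (n + 1)⌋₊ = M
    constructor
    · rintro ⟨h1, h2⟩
      rw [← h1, ← h2, Nat.div_add_mod]
    · rintro rfl
      have hz := ZMod.val_lt (z n)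
      rw [Nat.mul_add_div hb, Nat.mul_add_mod, Nat.div_eq_of_lt hz, Nat.mod_eq_of_lt hz]
      simp

theorem volume_real_unitCylinder (n : ℕ) (z : DigitGroup b) :
    volume.real (unitCylinder n z) = ((b : ℝ) ^ n)⁻¹ := by
  have hb : (0 : ℝ) < (b : ℝ) ^ n := pow_pos (Nat.cast_pos.2 (Nat.pos_of_neZero b)) n
  set J : Set ℝ := Set.Ico (leadingDigits z n / (b : ℝ) ^ n) ((leadingDigits z n + 1) / (b : ℝ) ^ n)
    with hJ
  have hae : unitCylinder n z =ᵐ[volume] ((↑) ⁻¹' J : Set unitInterval) := by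
    have h1 : ∀ᵐ u : unitInterval, u ≠ 1 := by
      simp [ae_iff]
    filter_upwards [h1] with u hu
    refine propext ((mem_unitCylinder_iff_floor hu n z).trans ?_)
    rw [Nat.floor_eq_iff (mul_nonneg u.2.1 hb.le), ← div_le_iff₀ hb, ← lt_div_iff₀ hb]
    rfl
  have hsub : J ⊆ unitInterval := by
    intro x hx
    refine ⟨le_trans (by positivity) hx.1, hx.2.le.trans ?_⟩
    rw [div_le_one hb]
    exact_mod_cast leadingDigits_lt z n
  rw [measureReal_congr hae, measureReal_def,
    unitInterval.measurePreserving_coe.measure_preimage measurableSet_Ico.nullMeasurableSet,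
    Measure.restrict_apply measurableSet_Ico, Set.inter_eq_left.2 hsub, Real.volume_Ico,
    ENNReal.toReal_ofReal (by rw [← sub_div]; simp)]
  rw [← sub_div]
  simp

/-- The points of the cube whose first `n` digits agree with those of `z` in every component. -/
def cylinder (n : ℕ) (z : Fin s → DigitGroup b) : Set (Cube s) :=
  Set.univ.pi fun j => unitCylinder n (z j)

theorem measurableSet_cylinder (n : ℕ) (z : Fin s → DigitGroup b) :
    MeasurableSet (cylinder n z) :=
  MeasurableSet.univ_pi fun j => measurableSet_unitCylinder n (z j)

theorem volume_real_cylinder (n : ℕ) (z : Fin s → DigitGroup b) :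
    volume.real (cylinder n z) = ((b : ℝ) ^ (n * s))⁻¹ := by
  rw [cylinder, volume_pi, measureReal_def, Measure.pi_pi, ENNReal.toReal_prod]
  simp_rw [← measureReal_def, volume_real_unitCylinder]
  simp [pow_mul]

theorem dist_projCube_le_of_mem_cylinder (hb : 2 ≤ b) {n : ℕ} {z : Fin s → DigitGroup b}
    {u : Cube s} (hu : u ∈ cylinder n z) : dist u (projCube z) ≤ ((b : ℝ) ^ n)⁻¹ :=
  (dist_pi_le_iff (by positivity)).2 fun j =>
    dist_proj_le_of_mem_unitCylinder hb (hu j (Set.mem_univ j))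

/-- Averages of a continuous function over the cylinders of `z` converge to its value at `π(z)`. -/
theorem tendsto_average_cylinder {E : Type*} [NormedAddCommGroup E] [NormedSpace ℝ E]
    [CompleteSpace E] (hb : 2 ≤ b) {φ : Cube s → E} (hφ : Continuous φ)
    (z : Fin s → DigitGroup b) :
    Filter.Tendsto (fun n : ℕ => (b : ℝ) ^ (n * s) • ∫ u in cylinder n z, φ u) Filter.atTop
      (nhds (φ (projCube z))) := by
  have hint : Integrable φ volume := hφ.integrable_of_hasCompactSupport (.of_compactSpace φ)
  rw [Metric.tendsto_nhds]
  intro ε hε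
  obtain ⟨δ, hδ, hφδ⟩ := Metric.continuous_iff.1 hφ (projCube z) (ε / 2) (half_pos hε)
  have hlim : Filter.Tendsto (fun n : ℕ => ((b : ℝ) ^ n)⁻¹) Filter.atTop (nhds 0) :=
    (tendsto_pow_atTop_atTop_of_one_lt (by exact_mod_cast hb)).inv_tendsto_atTop
  filter_upwards [hlim.eventually_lt_const hδ] with n hn
  have hpos : (0 : ℝ) < (b : ℝ) ^ (n * s) := pow_pos (by positivity) _
  have hconst : φ (projCube z) = (b : ℝ) ^ (n * s) • ∫ _ in cylinder n z, φ (projCube z) := by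
    rw [setIntegral_const, volume_real_cylinder, smul_smul, mul_inv_cancel₀ hpos.ne', one_smul]
  rw [dist_eq_norm, hconst, ← smul_sub, ← integral_sub hint.integrableOn
    (integrable_const _).integrableOn, norm_smul,
    Real.norm_of_nonneg hpos.le]
  have hle : ‖∫ u in cylinder n z, (φ u - φ (projCube z))‖ ≤
      ε / 2 * volume.real (cylinder n z) :=
    norm_setIntegral_le_of_norm_le_const (measure_lt_top _ _) fun u hu => by
      rw [← dist_eq_norm]
      exact (hφδ u ((dist_projCube_le_of_mem_cylinder hb hu).trans_lt hn)).le
  rw [volume_real_cylinder] at hle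
  calc (b : ℝ) ^ (n * s) * ‖∫ u in cylinder n z, (φ u - φ (projCube z))‖
      ≤ (b : ℝ) ^ (n * s) * (ε / 2 * ((b : ℝ) ^ (n * s))⁻¹) := by gcongr
    _ = ε / 2 := by field_simp
    _ < ε := half_lt_self hε

/-! ### Cylinders and Walsh functions -/

theorem norm_walshCube (k : Fin s → ℕ) (u : Cube s) : ‖walshCube b k u‖ = 1 := by
  rw [walshCube_eq_stdAddChar]
  exact AddChar.norm_apply _ _

/-- The normalized indicator of a cylinder is a partial sum of a Walsh series. -/
theorem indicator_cylinder_eq_sum (hb : 2 ≤ b) (n : ℕ) (z : Fin s → DigitGroup b) (u : Cube s) :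
    (((cylinder n z).indicator (fun _ => (b : ℝ) ^ (n * s)) u : ℝ) : ℂ) =
      ∑ k ∈ digitBox b s n,
        ZMod.stdAddChar (pairingCube k z) * (starRingEnd ℂ) (walshCube b k u) := by
  have h : ∀ k : Fin s → ℕ,
      (ZMod.stdAddChar (pairingCube k z) : ℂ) * (starRingEnd ℂ) (walshCube b k u) =
        ZMod.stdAddChar (pairingCube k (z - cubeDigits b u)) := fun k => by
    rw [walshCube_eq_stdAddChar, conj_stdAddChar, ← AddChar.map_add_eq_mul, pairingCube_sub,
      sub_eq_add_neg]
  simp_rw [h]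
  rw [sum_digitBox_stdAddChar hb]
  have hmem : u ∈ cylinder n z ↔ ∀ j, ∀ i < n, (z - cubeDigits b u) j i = 0 := by
    simp only [Pi.sub_apply, sub_eq_zero, eq_comm (a := z _ _)]
    simp [cylinder, unitCylinder, cubeDigits]
  by_cases hu : u ∈ cylinder n z
  · rw [Set.indicator_of_mem hu, if_pos (hmem.1 hu)]
    simp
  · rw [Set.indicator_of_notMem hu, if_neg (mt hmem.2 hu)]
    simp

end Cylinders

/-! ### The representer of the integration error -/

section Representer

variable {H : Type*} [NormedAddCommGroup H] [InnerProductSpace ℝ H] {s : ℕ}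
  [RKHS ℝ H (Cube s) ℝ]

/-- If the integration error is represented by `g`, then the worst-case error is `‖g‖`, and the
supremum defining it is attained. -/
theorem isGreatest_unitBallErrors {P : Multiset (Cube s)} {g : H}
    (hg : ∀ f : H, quadrature (fun x => f x) P - ∫ x : Cube s, f x = inner ℝ g f) :
    IsGreatest (unitBallErrors H P) ‖g‖ := by
  constructor
  · by_cases h0 : g = 0
    · exact ⟨0, by simp, by rw [hg]; simp [h0]⟩
    · have hpos : ‖g‖ ≠ 0 := norm_ne_zero_iff.2 h0
      refine ⟨‖g‖⁻¹ • g, ?_, ?_⟩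
      · rw [norm_smul, norm_inv, norm_norm, inv_mul_cancel₀ hpos]
      · rw [hg, inner_smul_right, real_inner_self_eq_norm_sq, sq, inv_mul_cancel_left₀ hpos,
          abs_norm]
  · rintro e ⟨f, hf, rfl⟩
    rw [hg]
    exact (abs_real_inner_le_norm g f).trans (mul_le_of_le_one_right (norm_nonneg g) hf)

variable (H) [CompleteSpace H]

/-- The kernel function `K(·, u)` as an element of the Hilbert space. -/
noncomputable def kernelSection (u : Cube s) : H := RKHS.kerFun H u 1

theorem inner_kernelSection (u : Cube s) (f : H) : inner ℝ (kernelSection H u) f = f u := by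
  simp [kernelSection]

theorem inner_kernelSection_kernelSection (u v : Cube s) :
    inner ℝ (kernelSection H u) (kernelSection H v) = reproducingKernel H u v := by
  rw [inner_kernelSection, reproducingKernel, kernelSection, RKHS.kerFun_apply]

variable {H}

theorem norm_kernelSection_sub (u v : Cube s) :
    ‖kernelSection H u - kernelSection H v‖ =
      √(reproducingKernel H u u - 2 * reproducingKernel H u v + reproducingKernel H v v) := by
  rw [← inner_kernelSection_kernelSection, ← inner_kernelSection_kernelSection,
    ← inner_kernelSection_kernelSection, real_inner_self_eq_norm_sq, real_inner_self_eq_norm_sq,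
    ← norm_sub_sq_real, Real.sqrt_sq (norm_nonneg _)]

theorem continuous_kernelSection
    (hcont : Continuous fun p : Cube s × Cube s => reproducingKernel H p.1 p.2) :
    Continuous (kernelSection H : Cube s → H) := by
  refine continuous_iff_continuousAt.2 fun v => tendsto_iff_norm_sub_tendsto_zero.2 ?_
  have h3 : Continuous fun u : Cube s => ‖kernelSection H u - kernelSection H v‖ := by
    simp_rw [norm_kernelSection_sub]
    -- With an opaque kernel, unification does not unfold the adjoints inside `reproducingKernel`.
    revert hcont
    generalize reproducingKernel H = K
    intro hcont
    have h1 : Continuous fun u : Cube s => K u u :=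
      hcont.comp (continuous_id.prodMk continuous_id)
    have h2 : Continuous fun u : Cube s => K u v :=
      hcont.comp (continuous_id.prodMk continuous_const)
    exact ((h1.sub (h2.const_mul 2)).add_const _).sqrt
  have h4 := h3.tendsto v
  rwa [sub_self, norm_zero] at h4

theorem continuous_apply_of_continuous_kernel
    (hcont : Continuous fun p : Cube s × Cube s => reproducingKernel H p.1 p.2) (f : H) :
    Continuous fun u : Cube s => f u := by
  simp_rw [← inner_kernelSection]
  exact (continuous_kernelSection hcont).inner continuous_const

/-- The squared norm of a weighted integral of kernel functions is a double integral of the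
kernel. -/
theorem norm_sq_integral_smul_kernelSection
    {w : Cube s → ℝ}
    (hw : Integrable (fun u => w u • (kernelSection H u : H)) volume) :
    ‖∫ u, w u • (kernelSection H u : H)‖ ^ 2 =
      ∫ p : Cube s × Cube s, w p.1 * w p.2 * reproducingKernel H p.1 p.2 := by
  set F : Cube s → H := fun u => w u • kernelSection H u with hF
  have hprod : Integrable (fun p : Cube s × Cube s => inner ℝ (F p.1) (F p.2)) volume := by
    refine (hw.norm.mul_prod hw.norm).mono'
      ((hw.aestronglyMeasurable.comp_fst).inner hw.aestronglyMeasurable.comp_snd) ?_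
    exact Filter.Eventually.of_forall fun p => norm_inner_le_norm _ _
  have hval : ∀ p : Cube s × Cube s,
      w p.1 * w p.2 * reproducingKernel H p.1 p.2 = inner ℝ (F p.1) (F p.2) := fun p => by
    rw [hF, real_inner_smul_left, real_inner_smul_right, inner_kernelSection_kernelSection,
      mul_assoc]
  simp_rw [hval]
  rw [Measure.volume_eq_prod] at hprod ⊢
  rw [integral_prod _ hprod, ← real_inner_self_eq_norm_sq, ← integral_inner hw]
  refine integral_congr_ae (Filter.Eventually.of_forall fun u => ?_)
  simp only []
  rw [real_inner_comm, ← integral_inner hw]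

end Representer

/-! ### The antithetic net -/

/-- The square partial sums belong to a cofinal sequence of finite sets, so they compute the sum of
any summable family. -/
theorem tendsto_digitBox_prod {b s : ℕ} (hb : 2 ≤ b) :
    Filter.Tendsto (fun n => digitBox b s n ×ˢ digitBox b s n) Filter.atTop Filter.atTop := by
  have hmono : Monotone fun n => digitBox b s n := fun n n' hn =>
    Fintype.piFinset_subset _ _ fun _ =>
      Finset.range_mono (Nat.pow_le_pow_right (by lia) hn)
  have hmem : ∀ k : Fin s → ℕ, ∃ n, k ∈ digitBox b s n := fun k =>
    ⟨∑ j, k j, Fintype.mem_piFinset.2 fun j => Finset.mem_range.2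
      ((Finset.single_le_sum (f := k) (fun _ _ => Nat.zero_le _) (Finset.mem_univ j)).trans_lt
        (Nat.lt_pow_self (by lia)))⟩
  refine Filter.tendsto_atTop_finset_of_monotone
    (fun n n' hn => Finset.product_subset_product (hmono hn) (hmono hn)) fun p => ?_
  obtain ⟨n₁, h₁⟩ := hmem p.1
  obtain ⟨n₂, h₂⟩ := hmem p.2
  exact ⟨max n₁ n₂, Finset.mem_product.2
    ⟨hmono (le_max_left _ _) h₁, hmono (le_max_right _ _) h₂⟩⟩

section Antithetic

variable {b m s : ℕ} [NeZero b] (C : Fin s → Matrix ℕ (Fin m) (ZMod b))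

/-- The point of the antithetic net obtained from the net point `z_h` by the shift `e_l`. -/
def antitheticPoint (p : ZMod b × ℕ) : Fin s → DigitGroup b := netPoint C p.2 + fun _ _ => p.1

/-- The index set of the points of the antithetic net. -/
def antitheticIndex (b m : ℕ) [NeZero b] : Finset (ZMod b × ℕ) :=
  Finset.univ ×ˢ Finset.range (b ^ m)

/-- The step function `b^(ns) |P|⁻¹ ∑_{z ∈ P} 1_{cyl_n(z)} - 1` for the antithetic net `P`. It
approximates the signed measure whose integral is the integration error. -/
noncomputable def errorDensity (n : ℕ) (u : Cube s) : ℝ :=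
  ((b : ℝ) ^ (m + 1))⁻¹ * ∑ p ∈ antitheticIndex b m,
    (cylinder n (antitheticPoint C p)).indicator (fun _ => (b : ℝ) ^ (n * s)) u - 1

/-- The nonzero vectors of the dual net with vanishing digit sum. -/
def antitheticDual : Set (Fin s → ℕ) := {k | k ∈ dualNet C \ {0} ∧ digitSum b k = 0}

open scoped Classical in
/-- Only the Walsh functions that the antithetic net integrates wrongly occur in the step function
approximating the integration error. -/
theorem errorDensity_eq_sum (hb : 2 ≤ b) (n : ℕ) (u : Cube s) :
    (errorDensity C n u : ℂ) = ∑ k ∈ digitBox b s n with k ∈ antitheticDual C,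
      (starRingEnd ℂ) (walshCube b k u) := by
  have hb0 : (b : ℂ) ^ (m + 1) ≠ 0 := pow_ne_zero _ (NeZero.ne _)
  have h : ((b : ℂ) ^ (m + 1))⁻¹ * ∑ p ∈ antitheticIndex b m, ∑ k ∈ digitBox b s n,
        (ZMod.stdAddChar (pairingCube k (antitheticPoint C p)) : ℂ) *
          (starRingEnd ℂ) (walshCube b k u) =
      ∑ k ∈ digitBox b s n with k ∈ dualNet C ∧ digitSum b k = 0,
        (starRingEnd ℂ) (walshCube b k u) := by
    rw [Finset.sum_comm, Finset.mul_sum, Finset.sum_filter]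
    refine Finset.sum_congr rfl fun k _ => ?_
    rw [← Finset.sum_mul, antitheticIndex]
    simp only [antitheticPoint]
    rw [sum_stdAddChar_antithetic hb]
    split_ifs <;> simp [hb0]
  have hsplit : ({k ∈ digitBox b s n | k ∈ dualNet C ∧ digitSum b k = 0} : Finset _) =
      insert 0 {k ∈ digitBox b s n | k ∈ antitheticDual C} := by
    ext k
    by_cases hk : k = 0
    · subst hk
      simp [digitBox, dualNet, digitSum, NeZero.pos]
    · simp [antitheticDual, hk]
  have hnot : (0 : Fin s → ℕ) ∉
      ({k ∈ digitBox b s n | k ∈ antitheticDual C} : Finset _) := by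
    simp [antitheticDual]
  have h0 : walshCube b (0 : Fin s → ℕ) u = 1 := by
    rw [walshCube_eq_stdAddChar, pairingCube_zero_left, AddChar.map_zero_eq_one]
  rw [hsplit, Finset.sum_insert hnot, h0, map_one] at h
  rw [errorDensity]
  push_cast
  simp_rw [indicator_cylinder_eq_sum hb]
  rw [h]
  ring

variable {H : Type*} [NormedAddCommGroup H] [InnerProductSpace ℝ H] [CompleteSpace H]
  [RKHS ℝ H (Cube s) ℝ]

variable (H) in
/-- The element of the Hilbert space that represents the integration error of the antithetic
net. -/
noncomputable def errorRepresenter : H :=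
  ((b : ℝ) ^ (m + 1))⁻¹ • ∑ p ∈ antitheticIndex b m,
    kernelSection H (projCube (antitheticPoint C p)) - ∫ u, (kernelSection H u : H)

theorem integrable_kernelSection
    (hcont : Continuous fun p : Cube s × Cube s => reproducingKernel H p.1 p.2) :
    Integrable (kernelSection H : Cube s → H) volume :=
  (continuous_kernelSection hcont).integrable_of_hasCompactSupport (.of_compactSpace _)

theorem quadrature_sub_integral_eq_inner
    (hcont : Continuous fun p : Cube s × Cube s => reproducingKernel H p.1 p.2) (f : H) :
    quadrature (fun x => f x) ((antithetic (digitalNet C)).map projCube) - ∫ x : Cube s, f x =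
      inner ℝ (errorRepresenter C H) f := by
  have hI : inner ℝ (∫ u, (kernelSection H u : H)) f = ∫ x : Cube s, f x := by
    rw [real_inner_comm, ← integral_inner (integrable_kernelSection hcont)]
    exact integral_congr_ae (.of_forall fun u => by
      simp only []
      rw [real_inner_comm, inner_kernelSection])
  rw [quadrature_antithetic, errorRepresenter, inner_sub_left, hI, real_inner_smul_left, sum_inner]
  simp_rw [inner_kernelSection]
  rfl

theorem errorDensity_smul_kernelSection (n : ℕ) (u : Cube s) :
    errorDensity C n u • (kernelSection H u : H) =
      ((b : ℝ) ^ (m + 1))⁻¹ • ∑ p ∈ antitheticIndex b m,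
        (b : ℝ) ^ (n * s) • (cylinder n (antitheticPoint C p)).indicator (kernelSection H) u -
      kernelSection H u := by
  rw [errorDensity, sub_smul, one_smul, mul_smul, Finset.sum_smul]
  congr 2
  refine Finset.sum_congr rfl fun p _ => ?_
  by_cases hu : u ∈ cylinder n (antitheticPoint C p) <;> simp [hu]

theorem integrable_sum_indicator_kernelSection
    (hcont : Continuous fun p : Cube s × Cube s => reproducingKernel H p.1 p.2) (n : ℕ) :
    Integrable (fun u => ((b : ℝ) ^ (m + 1))⁻¹ • ∑ p ∈ antitheticIndex b m,
      (b : ℝ) ^ (n * s) • (cylinder n (antitheticPoint C p)).indicator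
        (kernelSection H : Cube s → H) u) volume :=
  (integrable_finsetSum _ fun _ _ =>
    ((integrable_kernelSection hcont).indicator (measurableSet_cylinder n _)).smul _).smul _

theorem integrable_errorDensity_smul
    (hcont : Continuous fun p : Cube s × Cube s => reproducingKernel H p.1 p.2) (n : ℕ) :
    Integrable (fun u => errorDensity C n u • (kernelSection H u : H)) volume := by
  simp_rw [errorDensity_smul_kernelSection]
  exact (integrable_sum_indicator_kernelSection C hcont n).sub (integrable_kernelSection hcont)

theorem tendsto_integral_errorDensity (hb : 2 ≤ b)
    (hcont : Continuous fun p : Cube s × Cube s => reproducingKernel H p.1 p.2) :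
    Filter.Tendsto (fun n => ∫ u, errorDensity C n u • (kernelSection H u : H)) Filter.atTop
      (nhds (errorRepresenter C H)) := by
  have h : ∀ n, ∫ u, errorDensity C n u • (kernelSection H u : H) =
      ((b : ℝ) ^ (m + 1))⁻¹ • ∑ p ∈ antitheticIndex b m,
        ((b : ℝ) ^ (n * s) • ∫ u in cylinder n (antitheticPoint C p), (kernelSection H u : H)) -
      ∫ u, (kernelSection H u : H) := by
    intro n
    have hi : ∀ p, Integrable (fun u => (cylinder n (antitheticPoint C p)).indicator
        (kernelSection H : Cube s → H) u) volume := fun p =>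
      (integrable_kernelSection hcont).indicator (measurableSet_cylinder n _)
    have hs : ∀ p, Integrable (fun u => (b : ℝ) ^ (n * s) •
        (cylinder n (antitheticPoint C p)).indicator (kernelSection H : Cube s → H) u) volume :=
      fun p => (hi p).smul _
    simp_rw [errorDensity_smul_kernelSection]
    rw [integral_sub (integrable_sum_indicator_kernelSection C hcont n)
      (integrable_kernelSection hcont), integral_smul, integral_finsetSum _ fun p _ => hs p]
    simp_rw [integral_smul, integral_indicator (measurableSet_cylinder n _)]
  simp_rw [h]
  exact ((tendsto_finsetSum _ fun p _ => tendsto_average_cylinder hb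
    (continuous_kernelSection hcont) (antitheticPoint C p)).const_smul _).sub_const _

theorem integrable_kernel_mul_walshCube
    (hcont : Continuous fun p : Cube s × Cube s => reproducingKernel H p.1 p.2)
    (k l : Fin s → ℕ) :
    Integrable (fun p : Cube s × Cube s => (reproducingKernel H p.1 p.2 : ℂ) *
      (starRingEnd ℂ) (walshCube b k p.1) * walshCube b l p.2) volume := by
  have hK : Integrable (fun p : Cube s × Cube s => (reproducingKernel H p.1 p.2 : ℂ)) volume :=
    (Complex.continuous_ofReal.comp hcont).integrable_of_hasCompactSupport (.of_compactSpace _)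
  have h1 : Measurable fun p : Cube s × Cube s => (starRingEnd ℂ) (walshCube b k p.1) :=
    Complex.continuous_conj.measurable.comp ((measurable_walshCube k).comp measurable_fst)
  have h2 : Measurable fun p : Cube s × Cube s => walshCube b l p.2 :=
    (measurable_walshCube l).comp measurable_snd
  exact (hK.mul_bdd (c := 1) h1.aestronglyMeasurable (.of_forall fun p => by
    simp [norm_walshCube])).mul_bdd (c := 1) h2.aestronglyMeasurable (.of_forall fun p => by
    simp [norm_walshCube])

open scoped Classical in
/-- Expanding both step functions into Walsh functions turns the squared norm of the approximate
representer into a partial sum of the series of Walsh coefficients. -/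
theorem norm_sq_integral_errorDensity (hb : 2 ≤ b)
    (hcont : Continuous fun p : Cube s × Cube s => reproducingKernel H p.1 p.2) (n : ℕ) :
    ((‖∫ u, errorDensity C n u • (kernelSection H u : H)‖ ^ 2 : ℝ) : ℂ) =
      ∑ p ∈ digitBox b s n ×ˢ digitBox b s n,
        (antitheticDual C ×ˢ antitheticDual C).indicator
          (fun p => walshCoeff b (reproducingKernel H) p.1 p.2) p := by
  have hval : ∀ p : Cube s × Cube s,
      ((errorDensity C n p.1 * errorDensity C n p.2 * reproducingKernel H p.1 p.2 : ℝ) : ℂ) =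
      ∑ k ∈ digitBox b s n with k ∈ antitheticDual C,
        ∑ l ∈ digitBox b s n with l ∈ antitheticDual C,
          (reproducingKernel H p.1 p.2 : ℂ) *
            (starRingEnd ℂ) (walshCube b k p.1) * walshCube b l p.2 := by
    intro p
    -- The step function is real, so it is also the sum of the unconjugated Walsh functions.
    have h2 : (errorDensity C n p.2 : ℂ) = ∑ l ∈ digitBox b s n with l ∈ antitheticDual C,
        walshCube b l p.2 := by
      rw [← Complex.conj_ofReal, errorDensity_eq_sum C hb, map_sum]
      simp
    rw [Complex.ofReal_mul, Complex.ofReal_mul, h2, errorDensity_eq_sum C hb, Finset.sum_mul_sum,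
      Finset.sum_mul]
    refine Finset.sum_congr rfl fun k _ => ?_
    rw [Finset.sum_mul]
    exact Finset.sum_congr rfl fun l _ => by ring
  rw [norm_sq_integral_smul_kernelSection (integrable_errorDensity_smul C hcont n),
    ← integral_complex_ofReal]
  simp_rw [hval]
  rw [integral_finsetSum _ fun k _ => integrable_finsetSum _ fun l _ =>
    integrable_kernel_mul_walshCube hcont k l]
  simp_rw [integral_finsetSum _ fun l _ => integrable_kernel_mul_walshCube hcont _ l]
  rw [Finset.sum_product, Finset.sum_filter]
  refine Finset.sum_congr rfl fun k _ => ?_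
  rw [Finset.sum_filter]
  by_cases hk : k ∈ antitheticDual C
  · rw [if_pos hk]
    refine Finset.sum_congr rfl fun l _ => ?_
    by_cases hl : l ∈ antitheticDual C <;> simp [hk, hl, walshCoeff]
  · rw [if_neg hk]
    exact (Finset.sum_eq_zero fun l _ => by simp [hk]).symm

theorem hasSum_walshCoeff_norm_sq_errorRepresenter (hb : 2 ≤ b)
    (hcont : Continuous fun p : Cube s × Cube s => reproducingKernel H p.1 p.2)
    (hsum : Summable fun p : (Fin s → ℕ) × (Fin s → ℕ) =>
      ‖walshCoeff b (reproducingKernel H) p.1 p.2‖) :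
    HasSum ((antitheticDual C ×ˢ antitheticDual C).indicator
        fun p => walshCoeff b (reproducingKernel H) p.1 p.2)
      ((‖errorRepresenter C H‖ ^ 2 : ℝ) : ℂ) := by
  have hs := (hsum.of_norm.indicator (antitheticDual C ×ˢ antitheticDual C)).hasSum
  have h1 := hs.comp (tendsto_digitBox_prod (s := s) hb)
  have h2 := (Complex.continuous_ofReal.tendsto _).comp
    ((tendsto_integral_errorDensity C hb hcont).norm.pow 2)
  have h3 := h2.congr fun n => norm_sq_integral_errorDensity C hb hcont n
  rwa [tendsto_nhds_unique h1 h3] at hs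

end Antithetic

end QMC

theorem theorem3p8 (b : ℕ) [NeZero b] (hb : 2 ≤ b) (m s : ℕ)
    (C : Fin s → Matrix ℕ (Fin m) (ZMod b))
    (H : Type*) [NormedAddCommGroup H] [InnerProductSpace ℝ H] [CompleteSpace H]
    [RKHS ℝ H (QMC.Cube s) ℝ]
    (hcont : Continuous fun p : QMC.Cube s × QMC.Cube s => QMC.reproducingKernel H p.1 p.2)
    (hint : Integrable (fun x : QMC.Cube s => √(QMC.reproducingKernel H x x)) volume)
    (hsum : Summable fun p : (Fin s → ℕ) × (Fin s → ℕ) =>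
      ‖QMC.walshCoeff b (QMC.reproducingKernel H) p.1 p.2‖) :
    (∀ f : H, Integrable (fun x : QMC.Cube s => f x) volume) ∧
    BddAbove (QMC.unitBallErrors H
      ((QMC.antithetic (QMC.digitalNet C)).map QMC.projCube)) ∧
    HasSum
      (fun p : {p : (Fin s → ℕ) × (Fin s → ℕ) //
          (p.1 ∈ QMC.dualNet C \ {0} ∧ p.2 ∈ QMC.dualNet C \ {0}) ∧
          QMC.digitSum b p.1 = 0 ∧ QMC.digitSum b p.2 = 0} =>
        QMC.walshCoeff b (QMC.reproducingKernel H) p.1.1 p.1.2)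
      (((QMC.worstCaseError H
        ((QMC.antithetic (QMC.digitalNet C)).map QMC.projCube)) ^ 2 : ℝ) : ℂ) := by
  have hgreat := QMC.isGreatest_unitBallErrors (QMC.quadrature_sub_integral_eq_inner C hcont)
  refine ⟨fun f => (QMC.continuous_apply_of_continuous_kernel hcont f)
    |>.integrable_of_hasCompactSupport (.of_compactSpace _), hgreat.bddAbove, ?_⟩
  rw [QMC.worstCaseError, hgreat.csSup_eq]
  have hset : {p : (Fin s → ℕ) × (Fin s → ℕ) |
      (p.1 ∈ QMC.dualNet C \ {0} ∧ p.2 ∈ QMC.dualNet C \ {0}) ∧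
      QMC.digitSum b p.1 = 0 ∧ QMC.digitSum b p.2 = 0} =
      QMC.antitheticDual C ×ˢ QMC.antitheticDual C := by
    ext p
    exact and_and_and_comm
  have h := QMC.hasSum_walshCoeff_norm_sq_errorRepresenter C hb hcont hsum
  rw [← hset] at h
  exact hasSum_subtype_iff_indicator.2 h
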